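/- For each integer $n\ge 1$ let $a_n$ be the number of subrings of $\mathbb{Z}[t]/(t^3)$ that contain the identity element $1$ and whose additive group has index $n$ in $\mathbb{Z}[t]/(t^3)$; each $a_n$ is finite. Then, as $B\to\infty$ through the real numbers, $$\sum_{1\le n\le B} a_n \;\sim\; \frac{1}{12\,\zeta(2)}\, B\,(\ln B)^2,$$ where $\zeta$ is the Riemann zeta function; that is, the ratio of the two sides tends to $1$. -/

import Mathlib

/-- The ring `ℤ[t]/(t³)`. -/
abbrev TruncRing : Type :=
  Polynomial ℤ ⧸ Ideal.span {(Polynomial.X ^ 3 : Polynomial ℤ)}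

/-- The set of subrings with identity of `ℤ[t]/(t³)` whose additive group has index `n`.
For `n ≥ 1` this means that the quotient group has exactly `n` elements; in Mathlib, index `0`
stands for infinite index. -/
def subringsOfIndex (n : ℕ) : Set (Subring TruncRing) :=
  {S | S.toAddSubgroup.index = n}

/-- The number `a_n` of subrings with identity of `ℤ[t]/(t³)` of index `n`. -/
noncomputable def subringCount (n : ℕ) : ℕ :=
  (subringsOfIndex n).ncard

/-!
A subring of finite index is `ℤ + Λ` for a lattice `Λ ⊆ ℤt + ℤt²`. In Hermite normal form `Λ` is
spanned by `at + bt²` and `dt²` with `0 ≤ b < d`, and `ℤ + Λ` is closed under multiplication if and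
only if `d ∣ a²`. Hence `a_n` is the sum of `d` over all factorizations `n = ad` with `d ∣ a²`.

Write `d = q l²` with `q` squarefree. Then `d ∣ a²` means `ql ∣ a`, so that
`∑_{n ≤ N} a_n = ∑_l l² S(N / l³)` with `S(N) = ∑_q q ⌊N / q²⌋` over squarefree `q`.
Möbius inversion gives `∑_{q ≤ y} 1 / q = log y / ζ(2) + O(1)` over squarefree `q`, whence
`S(z) = z log z / (2 ζ(2)) + O(z)`. With `B = x³`, the main term is therefore
`3 x³ / (2 ζ(2)) * ∑_{l ≤ x} log (x / l) / l`; the last sum is `(log x)² / 2 + O(log x)` by Abel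
summation, and `(log x)² = (log B)² / 9` produces the constant `1 / (12 ζ(2))`.
-/

open Polynomial Finset

section Lattices

theorem index_eq_index_map_fst_mul_index_comap_inr {A B : Type*} [AddCommGroup A] [AddCommGroup B]
    (H : AddSubgroup (A × B)) :
    H.index = (H.map (AddMonoidHom.fst A B)).index * (H.comap (AddMonoidHom.inr A B)).index := by
  have hker : (AddMonoidHom.fst A B).ker = (AddMonoidHom.inr A B).range := by
    ext ⟨a, b⟩
    simp [AddSubgroup.mem_prod, eq_comm]
  have hrange : (AddMonoidHom.fst A B).range = ⊤ :=
    AddMonoidHom.range_eq_top.2 Prod.fst_surjective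
  rw [AddSubgroup.index_map, hrange, AddSubgroup.index_top, mul_one, AddSubgroup.index_comap, hker,
    ← AddSubgroup.relIndex_sup_right, sup_comm, mul_comm,
    AddSubgroup.relIndex_mul_index le_sup_right]

theorem exists_nat_eq_zmultiples (H : AddSubgroup ℤ) :
    ∃ d : ℕ, H = AddSubgroup.zmultiples (d : ℤ) := by
  obtain ⟨a, rfl⟩ := Int.subgroup_cyclic H
  exact ⟨a.natAbs, by rw [← AddSubgroup.zmultiples_eq_closure, Int.zmultiples_natAbs]⟩

/-- The sublattice of `ℤ²` spanned by the rows of the matrix `(a b; 0 d)`. Every sublattice of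
finite index is of this form, with `0 ≤ b < d`: this is its Hermite normal form. -/
def hermiteLattice (a b d : ℤ) : AddSubgroup (ℤ × ℤ) :=
  AddSubgroup.closure {(a, b), (0, d)}

theorem mem_hermiteLattice {a b d : ℤ} {v : ℤ × ℤ} :
    v ∈ hermiteLattice a b d ↔ ∃ u, v.1 = u * a ∧ d ∣ v.2 - u * b := by
  obtain ⟨x, y⟩ := v
  simp only [hermiteLattice, AddSubgroup.mem_closure_pair, Prod.smul_mk, Prod.mk_add_mk,
    Prod.mk.injEq, smul_eq_mul, mul_zero, add_zero, dvd_def]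
  constructor
  · rintro ⟨u, v, rfl, rfl⟩
    exact ⟨u, rfl, v, by ring⟩
  · rintro ⟨u, rfl, v, hv⟩
    exact ⟨u, v, rfl, by linear_combination -hv⟩

theorem mem_hermiteLattice_of_fst_eq {a b d : ℤ} (ha : a ≠ 0) {u y : ℤ} :
    (u * a, y) ∈ hermiteLattice a b d ↔ d ∣ y - u * b := by
  rw [mem_hermiteLattice]
  refine ⟨?_, fun h => ⟨u, rfl, h⟩⟩
  rintro ⟨w, hw, h⟩
  rwa [mul_right_cancel₀ ha hw]

theorem map_fst_hermiteLattice (a b d : ℤ) :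
    (hermiteLattice a b d).map (AddMonoidHom.fst ℤ ℤ) = AddSubgroup.zmultiples a := by
  ext x
  simp only [AddSubgroup.mem_map, mem_hermiteLattice, AddMonoidHom.coe_fst,
    AddSubgroup.mem_zmultiples_iff, smul_eq_mul]
  constructor
  · rintro ⟨v, ⟨u, hu, -⟩, rfl⟩
    exact ⟨u, hu.symm⟩
  · rintro ⟨u, rfl⟩
    exact ⟨(u * a, u * b), ⟨u, rfl, by simp⟩, rfl⟩

theorem comap_inr_hermiteLattice {a : ℤ} (ha : a ≠ 0) (b d : ℤ) :
    (hermiteLattice a b d).comap (AddMonoidHom.inr ℤ ℤ) = AddSubgroup.zmultiples d := by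
  ext y
  simpa [Int.mem_zmultiples_iff] using mem_hermiteLattice_of_fst_eq ha (b := b) (d := d) (u := 0)

theorem index_hermiteLattice {a : ℕ} (ha : a ≠ 0) (b : ℤ) (d : ℕ) :
    (hermiteLattice a b d).index = a * d := by
  rw [index_eq_index_map_fst_mul_index_comap_inr, map_fst_hermiteLattice,
    comap_inr_hermiteLattice (mod_cast ha), Int.index_zmultiples, Int.index_zmultiples,
    Int.natAbs_natCast, Int.natAbs_natCast]

theorem hermiteLattice_emod (a b d : ℤ) : hermiteLattice a (b % d) d = hermiteLattice a b d := by
  ext v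
  simp only [mem_hermiteLattice]
  refine exists_congr fun u => and_congr_right fun _ => ?_
  rw [Int.emod_def, ← dvd_add_right (Dvd.intro (-(u * (b / d))) rfl : d ∣ d * -(u * (b / d)))]
  ring_nf

theorem eq_hermiteLattice {H : AddSubgroup (ℤ × ℤ)} {a b d : ℤ} (hab : (a, b) ∈ H)
    (hfst : H.map (AddMonoidHom.fst ℤ ℤ) = AddSubgroup.zmultiples a)
    (hinr : H.comap (AddMonoidHom.inr ℤ ℤ) = AddSubgroup.zmultiples d) :
    H = hermiteLattice a b d := by
  have hmem (u y : ℤ) : (u * a, y) ∈ H ↔ d ∣ y - u * b := by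
    have hsplit : (u * a, y) = u • (a, b) + (0, y - u * b) := by simp
    rw [hsplit, H.add_mem_cancel_left (H.zsmul_mem hab u), ← Int.mem_zmultiples_iff, ← hinr]
    rfl
  ext ⟨x, y⟩
  rw [mem_hermiteLattice]
  constructor
  · intro h
    obtain ⟨u, rfl⟩ : x ∈ AddSubgroup.zmultiples a := hfst ▸ ⟨(x, y), h, rfl⟩
    exact ⟨u, rfl, (hmem u y).1 h⟩
  · rintro ⟨u, rfl, h⟩
    exact (hmem u y).2 h

theorem exists_hermiteLattice_eq {H : AddSubgroup (ℤ × ℤ)} (hH : H.index ≠ 0) :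
    ∃ a b d : ℕ, a * d = H.index ∧ b < d ∧ hermiteLattice a b d = H := by
  obtain ⟨a, ha⟩ := exists_nat_eq_zmultiples (H.map (AddMonoidHom.fst ℤ ℤ))
  obtain ⟨d, hd⟩ := exists_nat_eq_zmultiples (H.comap (AddMonoidHom.inr ℤ ℤ))
  have hindex : H.index = a * d := by
    rw [index_eq_index_map_fst_mul_index_comap_inr, ha, hd, Int.index_zmultiples,
      Int.index_zmultiples, Int.natAbs_natCast, Int.natAbs_natCast]
  have hd0 : 0 < d := Nat.pos_of_ne_zero (right_ne_zero_of_mul (hindex ▸ hH))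
  obtain ⟨⟨_, c⟩, hac, rfl : _ = (a : ℤ)⟩ : (a : ℤ) ∈ H.map (AddMonoidHom.fst ℤ ℤ) :=
    ha ▸ AddSubgroup.mem_zmultiples _
  lift c % d to ℕ using Int.emod_nonneg c (by lia) with b hb
  refine ⟨a, b, d, hindex.symm, ?_, ?_⟩
  · have := Int.emod_lt_of_pos c (by lia : 0 < (d : ℤ))
    lia
  · rw [hb, hermiteLattice_emod, ← eq_hermiteLattice hac ha hd]

theorem hermiteLattice_inj {a b d a' b' d' : ℕ} (ha : a ≠ 0) (hb : b < d) (hb' : b' < d')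
    (h : hermiteLattice a b d = hermiteLattice a' b' d') : a = a' ∧ b = b' ∧ d = d' := by
  have hinj {k l : ℕ} (hkl : AddSubgroup.zmultiples (k : ℤ) = .zmultiples (l : ℤ)) : k = l := by
    simpa using congrArg AddSubgroup.index hkl
  obtain rfl : a = a' := hinj (by rw [← map_fst_hermiteLattice, h, map_fst_hermiteLattice])
  have ha' : (a : ℤ) ≠ 0 := mod_cast ha
  obtain rfl : d = d' := hinj (by
    rw [← comap_inr_hermiteLattice ha', h, comap_inr_hermiteLattice ha'])
  have hdvd : (d : ℤ) ∣ b - b' := by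
    rw [← one_mul (b' : ℤ), ← mem_hermiteLattice_of_fst_eq ha', ← h,
      mem_hermiteLattice_of_fst_eq ha']
    simp
  have := Int.eq_zero_of_abs_lt_dvd hdvd (by rw [abs_lt]; lia)
  exact ⟨rfl, by lia, rfl⟩

/-- The condition on a sublattice `Λ` of `ℤ²`, regarded as `ℤt + ℤt²`, for `ℤ + Λ` to be a subring
of `ℤ[t]/(t³)`: the product of `(x, y)` and `(x', y')` is `(0, xx')`. -/
def IsMulClosed (Λ : AddSubgroup (ℤ × ℤ)) : Prop :=
  ∀ v ∈ Λ, ∀ w ∈ Λ, (0, v.1 * w.1) ∈ Λ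

theorem isMulClosed_hermiteLattice_iff {a b d : ℤ} (ha : a ≠ 0) :
    IsMulClosed (hermiteLattice a b d) ↔ d ∣ a ^ 2 := by
  have hmem (y : ℤ) : (0, y) ∈ hermiteLattice a b d ↔ d ∣ y := by
    simpa using mem_hermiteLattice_of_fst_eq ha (b := b) (d := d) (u := 0) (y := y)
  constructor
  · intro h
    have hab : (a, b) ∈ hermiteLattice a b d := mem_hermiteLattice.2 ⟨1, by simp⟩
    rw [sq, ← hmem]
    exact h _ hab _ hab
  · intro h v hv w hw
    obtain ⟨u, hu, -⟩ := mem_hermiteLattice.1 hv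
    obtain ⟨u', hu', -⟩ := mem_hermiteLattice.1 hw
    rw [hmem, hu, hu']
    exact h.trans ⟨u * u', by ring⟩

/-- The parameters `((a, d), b)` of the lattices `hermiteLattice a b d` of index `n` that satisfy
`IsMulClosed`. -/
def hermiteParams (n : ℕ) : Finset (Σ _ : ℕ × ℕ, ℕ) :=
  {p ∈ n.divisorsAntidiagonal | p.2 ∣ p.1 ^ 2}.sigma fun p => range p.2

theorem mk_mem_hermiteParams {n a b d : ℕ} :
    ⟨(a, d), b⟩ ∈ hermiteParams n ↔ a * d = n ∧ n ≠ 0 ∧ d ∣ a ^ 2 ∧ b < d := by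
  simp [hermiteParams, and_assoc]

theorem bijOn_hermiteLattice {n : ℕ} (hn : n ≠ 0) :
    Set.BijOn (fun p : Σ _ : ℕ × ℕ, ℕ => hermiteLattice p.1.1 p.2 p.1.2) (hermiteParams n)
      {Λ | Λ.index = n ∧ IsMulClosed Λ} := by
  have hclosed {a b d : ℕ} (ha : a ≠ 0) : IsMulClosed (hermiteLattice a b d) ↔ d ∣ a ^ 2 := by
    rw [isMulClosed_hermiteLattice_iff (mod_cast ha)]
    norm_cast
  refine ⟨?_, ?_, ?_⟩
  · rintro ⟨⟨a, d⟩, b⟩ hp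
    obtain ⟨rfl, hn, hda, -⟩ := mk_mem_hermiteParams.1 hp
    have ha := left_ne_zero_of_mul hn
    exact ⟨index_hermiteLattice ha b d, (hclosed ha).2 hda⟩
  · rintro ⟨⟨a, d⟩, b⟩ hp ⟨⟨a', d'⟩, b'⟩ hp' heq
    obtain ⟨rfl, hn, -, hb⟩ := mk_mem_hermiteParams.1 hp
    obtain ⟨-, -, -, hb'⟩ := mk_mem_hermiteParams.1 hp'
    obtain ⟨rfl, rfl, rfl⟩ := hermiteLattice_inj (left_ne_zero_of_mul hn) hb hb' heq
    rfl
  · rintro Λ ⟨rfl, hΛ⟩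
    obtain ⟨a, b, d, hindex, hb, rfl⟩ := exists_hermiteLattice_eq hn
    have ha := left_ne_zero_of_mul (hindex ▸ hn)
    exact ⟨⟨(a, d), b⟩, mk_mem_hermiteParams.2 ⟨hindex, hn, (hclosed ha).1 hΛ, hb⟩, rfl⟩

end Lattices

namespace TruncRing

/-- The coefficients of `t` and `t²` of an element of `ℤ[t]/(t³)`. -/
noncomputable def tail : TruncRing →+ ℤ × ℤ :=
  QuotientAddGroup.lift _ ((lcoeff ℤ 1).prod (lcoeff ℤ 2)).toAddMonoidHom fun p hp => by
    have hdvd : (X ^ 3 : ℤ[X]) ∣ p := Ideal.mem_span_singleton.1 hp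
    exact Prod.ext (X_pow_dvd_iff.1 hdvd 1 (by norm_num)) (X_pow_dvd_iff.1 hdvd 2 (by norm_num))

theorem tail_mk (p : ℤ[X]) : tail (Ideal.Quotient.mk _ p) = (p.coeff 1, p.coeff 2) :=
  rfl

theorem tail_surjective : Function.Surjective tail := fun v =>
  ⟨Ideal.Quotient.mk _ (C v.1 * X + C v.2 * X ^ 2), by
    rw [tail_mk]
    simp [-eq_intCast, coeff_X_pow]⟩

theorem tail_intCast (m : ℤ) : tail m = 0 := by
  rw [← map_intCast (Ideal.Quotient.mk (Ideal.span {(X ^ 3 : ℤ[X])})) m, tail_mk,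
    ← C_eq_intCast]
  simp [-eq_intCast]

theorem exists_intCast_of_tail_eq_zero {x : TruncRing} (hx : tail x = 0) : ∃ m : ℤ, m = x := by
  obtain ⟨p, rfl⟩ := Ideal.Quotient.mk_surjective x
  obtain ⟨h1, h2⟩ := Prod.ext_iff.1 ((tail_mk p).symm.trans hx)
  refine ⟨p.coeff 0, ?_⟩
  rw [← map_intCast (Ideal.Quotient.mk (Ideal.span {(X ^ 3 : ℤ[X])})), Ideal.Quotient.eq,
    Ideal.mem_span_singleton, X_pow_dvd_iff, ← C_eq_intCast]
  intro i hi
  rw [coeff_sub]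
  interval_cases i <;> simp_all [-eq_intCast, coeff_C]

theorem exists_tail_mul_eq (x y : TruncRing) :
    ∃ m n : ℤ, tail (x * y) = m • tail y + n • tail x + (0, (tail x).1 * (tail y).1) := by
  obtain ⟨p, rfl⟩ := Ideal.Quotient.mk_surjective x
  obtain ⟨q, rfl⟩ := Ideal.Quotient.mk_surjective y
  refine ⟨p.coeff 0, q.coeff 0, ?_⟩
  rw [← map_mul, tail_mk, tail_mk, tail_mk]
  ext <;> simp [coeff_mul, Nat.antidiagonal_succ] <;> ring

theorem comap_map_tail (S : Subring TruncRing) :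
    (S.toAddSubgroup.map tail).comap tail = S.toAddSubgroup := by
  refine AddSubgroup.comap_map_eq_self fun x hx => ?_
  obtain ⟨m, rfl⟩ := exists_intCast_of_tail_eq_zero hx
  exact intCast_mem S m

theorem isMulClosed_map_tail (S : Subring TruncRing) : IsMulClosed (S.toAddSubgroup.map tail) := by
  rintro _ ⟨x, hx, rfl⟩ _ ⟨y, hy, rfl⟩
  obtain ⟨m, n, hmul⟩ := exists_tail_mul_eq x y
  refine ⟨x * y - m • y - n • x, S.sub_mem (S.sub_mem (S.mul_mem hx hy)
    (S.zsmul_mem hy m)) (S.zsmul_mem hx n), ?_⟩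
  rw [map_sub, map_sub, map_zsmul, map_zsmul, hmul]
  abel

/-- The subring `ℤ + Λ` of `ℤ[t]/(t³)` for a lattice `Λ ⊆ ℤt + ℤt²`. -/
noncomputable def subringOfLattice (Λ : AddSubgroup (ℤ × ℤ)) (hΛ : IsMulClosed Λ) :
    Subring TruncRing where
  __ := Λ.comap tail
  one_mem' := by
    have hone : tail 1 = 0 := by simpa using tail_intCast 1
    exact (Λ.comap tail).mem_carrier.2 (by simp [hone])
  mul_mem' {x y} hx hy := by
    obtain ⟨m, n, hmul⟩ := exists_tail_mul_eq x y
    change tail (x * y) ∈ Λ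
    rw [hmul]
    exact add_mem (add_mem (zsmul_mem hy m) (zsmul_mem hx n)) (hΛ _ hx _ hy)

theorem bijOn_map_tail (n : ℕ) :
    Set.BijOn (fun S : Subring TruncRing => S.toAddSubgroup.map tail) (subringsOfIndex n)
      {Λ | Λ.index = n ∧ IsMulClosed Λ} := by
  refine ⟨fun S hS => ⟨?_, isMulClosed_map_tail S⟩, fun S _ T _ hST => ?_, fun Λ hΛ => ?_⟩
  · rw [← AddSubgroup.index_comap_of_surjective _ tail_surjective, comap_map_tail]
    exact hS
  · refine Subring.toAddSubgroup_injective ?_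
    rw [← comap_map_tail S, ← comap_map_tail T]
    exact congrArg (AddSubgroup.comap tail) hST
  · exact ⟨subringOfLattice Λ hΛ.2,
      (Λ.index_comap_of_surjective tail_surjective).trans hΛ.1,
      AddSubgroup.map_comap_eq_self_of_surjective tail_surjective Λ⟩

end TruncRing

theorem finite_subringsOfIndex {n : ℕ} (hn : n ≠ 0) : (subringsOfIndex n).Finite :=
  (TruncRing.bijOn_map_tail n).finite_iff_finite.2
    ((bijOn_hermiteLattice hn).finite_iff_finite.1 (hermiteParams n).finite_toSet)

theorem subringCount_eq_sum {n : ℕ} (hn : n ≠ 0) :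
    subringCount n = ∑ p ∈ n.divisorsAntidiagonal with p.2 ∣ p.1 ^ 2, p.2 :=
  calc subringCount n = {Λ : AddSubgroup (ℤ × ℤ) | Λ.index = n ∧ IsMulClosed Λ}.ncard :=
        (TruncRing.bijOn_map_tail n).ncard_eq
    _ = (hermiteParams n : Set (Σ _ : ℕ × ℕ, ℕ)).ncard := (bijOn_hermiteLattice hn).ncard_eq.symm
    _ = ∑ p ∈ n.divisorsAntidiagonal with p.2 ∣ p.1 ^ 2, p.2 := by
        rw [Set.ncard_coe_finset, hermiteParams, card_sigma]
        simp only [card_range]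

section Squarefree

theorem sq_dvd_squarefree_mul_sq_iff {q j l : ℕ} (hq : Squarefree q) :
    j ^ 2 ∣ q * l ^ 2 ↔ j ∣ l := by
  refine ⟨fun h => ?_, fun h => (pow_dvd_pow_of_dvd h 2).mul_left q⟩
  rcases eq_or_ne l 0 with rfl | hl
  · exact dvd_zero j
  obtain ⟨g, j', l', hg, hcop, rfl, rfl⟩ :=
    Nat.exists_coprime' (Nat.gcd_pos_of_pos_right j (Nat.pos_of_ne_zero hl))
  have hdvd : j' ^ 2 ∣ q * l' ^ 2 := by
    rwa [mul_pow, mul_pow, ← mul_assoc, Nat.mul_dvd_mul_iff_right (by positivity)] at h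
  have hunit : IsUnit j' := hq j' (sq j' ▸ (hcop.pow 2 2).dvd_of_dvd_mul_right hdvd)
  rw [Nat.isUnit_iff.1 hunit, one_mul]
  exact dvd_mul_left g l'

theorem squarefree_mul_sq_inj {q l r m : ℕ} (hq : Squarefree q) (hr : Squarefree r)
    (hl : l ≠ 0) (h : q * l ^ 2 = r * m ^ 2) : q = r ∧ l = m := by
  obtain rfl : l = m := Nat.dvd_antisymm
    ((sq_dvd_squarefree_mul_sq_iff hr).1 (h ▸ dvd_mul_left _ _))
    ((sq_dvd_squarefree_mul_sq_iff hq).1 (h ▸ dvd_mul_left _ _))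
  exact ⟨Nat.eq_of_mul_eq_mul_right (by positivity) h, rfl⟩

theorem squarefree_mul_sq_dvd_sq_iff {q l a : ℕ} (hq : Squarefree q) :
    q * l ^ 2 ∣ a ^ 2 ↔ q * l ∣ a := by
  constructor
  · intro h
    obtain ⟨c, rfl⟩ : l ∣ a := (Nat.pow_dvd_pow_iff two_ne_zero).1 ((dvd_mul_left _ _).trans h)
    rcases Nat.eq_zero_or_pos l with rfl | hl
    · simp
    rw [mul_pow, mul_comm (l ^ 2), Nat.mul_dvd_mul_iff_right (by positivity),
      hq.dvd_pow_iff_dvd two_ne_zero] at h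
    rw [mul_comm l]
    exact mul_dvd_mul_right h l
  · rintro ⟨c, rfl⟩
    exact ⟨q * c ^ 2, by ring⟩

theorem exists_squarefree_mul_sq_eq {n : ℕ} (hn : n ≠ 0) :
    ∃ q l, Squarefree q ∧ q * l ^ 2 = n ∧ q ∈ Icc 1 n ∧ l ∈ Icc 1 n := by
  obtain ⟨q, l, hql, hq⟩ := Nat.sq_mul_squarefree n
  have hdvd : q ∣ n ∧ l ∣ n := by
    rw [← hql]
    exact ⟨dvd_mul_left _ _, (dvd_pow_self l two_ne_zero).mul_right q⟩
  have hmem {k : ℕ} (hk : k ∣ n) : k ∈ Icc 1 n :=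
    mem_Icc.2 ⟨Nat.pos_of_dvd_of_pos hk (Nat.pos_of_ne_zero hn), Nat.le_of_dvd (by lia) hk⟩
  exact ⟨q, l, hq, by rw [mul_comm, hql], hmem hdvd.1, hmem hdvd.2⟩

end Squarefree

section SumsOverIcc

variable {M : Type*} [AddCommMonoid M]

theorem sum_Icc_one_eq_of_forall_eq_zero {f : ℕ → M} {m n : ℕ} (hm : ∀ k, m < k → f k = 0)
    (hn : ∀ k, n < k → f k = 0) : ∑ k ∈ Icc 1 m, f k = ∑ k ∈ Icc 1 n, f k := by
  wlog hmn : m ≤ n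
  · exact (this hn hm (le_of_not_ge hmn)).symm
  · refine sum_subset (Icc_subset_Icc_right hmn) fun k hk hk' => hm k ?_
    rw [mem_Icc] at hk hk'
    lia

theorem sum_Icc_filter_dvd (f : ℕ → M) (N : ℕ) {k : ℕ} (hk : k ≠ 0) :
    ∑ n ∈ Icc 1 N with k ∣ n, f n = ∑ m ∈ Icc 1 (N / k), f (k * m) := by
  have hk' : 0 < k := Nat.pos_of_ne_zero hk
  have himage : (Icc 1 N).filter (k ∣ ·) = (Icc 1 (N / k)).image (k * ·) := by
    ext n
    simp only [mem_filter, mem_Icc, mem_image, Nat.le_div_iff_mul_le hk']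
    constructor
    · rintro ⟨⟨hn, hnN⟩, m, rfl⟩
      exact ⟨m, ⟨Nat.pos_of_mul_pos_left hn, by lia⟩, rfl⟩
    · rintro ⟨m, ⟨hm, hmN⟩, rfl⟩
      exact ⟨⟨Nat.mul_pos hk' hm, by lia⟩, dvd_mul_right k m⟩
  rw [himage, sum_image fun _ _ _ _ h => Nat.eq_of_mul_eq_mul_left hk' h]

theorem sum_Icc_sum_divisorsAntidiagonal (f : ℕ → ℕ → M) (N : ℕ) :
    ∑ n ∈ Icc 1 N, ∑ p ∈ n.divisorsAntidiagonal, f p.1 p.2 =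
      ∑ d ∈ Icc 1 N, ∑ a ∈ Icc 1 (N / d), f a d :=
  calc ∑ n ∈ Icc 1 N, ∑ p ∈ n.divisorsAntidiagonal, f p.1 p.2
      = ∑ n ∈ Icc 1 N, ∑ d ∈ n.divisors, f (n / d) d :=
        sum_congr rfl fun n _ => Nat.sum_divisorsAntidiagonal' f
    _ = ∑ d ∈ Icc 1 N, ∑ n ∈ Icc 1 N with d ∣ n, f (n / d) d := by
        refine sum_comm' fun n d => ?_
        simp only [mem_Icc, Nat.mem_divisors, mem_filter]
        constructor
        · rintro ⟨hn, hd, -⟩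
          exact ⟨⟨hn, hd⟩, Nat.pos_of_dvd_of_pos hd hn.1, (Nat.le_of_dvd hn.1 hd).trans hn.2⟩
        · rintro ⟨⟨hn, hd⟩, -⟩
          exact ⟨hn, hd, Nat.ne_of_gt hn.1⟩
    _ = ∑ d ∈ Icc 1 N, ∑ a ∈ Icc 1 (N / d), f a d := by
        refine sum_congr rfl fun d hd => ?_
        have hd' : 0 < d := (mem_Icc.1 hd).1
        rw [sum_Icc_filter_dvd _ _ hd'.ne']
        exact sum_congr rfl fun a _ => by rw [Nat.mul_div_cancel_left a hd']

theorem sum_Icc_eq_sum_squarefree_mul_sq {f : ℕ → M} {N : ℕ} (hf : ∀ d, N < d → f d = 0) :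
    ∑ d ∈ Icc 1 N, f d = ∑ l ∈ Icc 1 N, ∑ q ∈ Icc 1 N with Squarefree q, f (q * l ^ 2) := by
  rw [← sum_product']
  have hrestrict :
      ∑ p ∈ Icc 1 N ×ˢ Icc 1 N with Squarefree p.2 ∧ p.2 * p.1 ^ 2 ≤ N, f (p.2 * p.1 ^ 2) =
        ∑ p ∈ Icc 1 N ×ˢ {q ∈ Icc 1 N | Squarefree q}, f (p.2 * p.1 ^ 2) := by
    refine sum_subset (fun p => ?_) fun p hp hp' => hf _ (lt_of_not_ge fun h => hp' ?_)
    · simp only [mem_filter, mem_product]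
      tauto
    · simp only [mem_filter, mem_product] at hp ⊢
      tauto
  rw [← hrestrict]
  symm
  refine sum_nbij (fun p => p.2 * p.1 ^ 2) (fun p => ?_) (fun p hp p' hp' h => ?_)
    (fun d hd => ?_) fun p _ => rfl
  · simp only [mem_filter, mem_product, mem_Icc]
    rintro ⟨⟨⟨hl, -⟩, hq, -⟩, -, h⟩
    exact ⟨Nat.mul_pos hq (Nat.pow_pos hl), h⟩
  · simp only [coe_filter, mem_product, mem_Icc, Set.mem_ofPred_eq] at hp hp'
    obtain ⟨hq, hl⟩ := squarefree_mul_sq_inj hp.2.1 hp'.2.1 (by lia) h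
    exact Prod.ext hl hq
  · rw [coe_Icc, Set.mem_Icc] at hd
    obtain ⟨q, l, hq, rfl, hqd, hld⟩ := exists_squarefree_mul_sq_eq (n := d) (by lia)
    have hmono : Icc 1 (q * l ^ 2) ⊆ Icc 1 N := Icc_subset_Icc_right hd.2
    exact ⟨(l, q), mem_filter.2 ⟨mem_product.2 ⟨hmono hld, hmono hqd⟩, hq, hd.2⟩, rfl⟩

end SumsOverIcc

/-- The sum of all squarefree `q` with `q² ∣ n`, over `n ≤ N`: the summatory function of the
Dirichlet series `ζ(s) ζ(2s - 1) / ζ(4s - 2)`. -/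
def squarefreeDivisorSum (N : ℕ) : ℕ :=
  ∑ q ∈ Icc 1 N with Squarefree q, q * (N / q ^ 2)

theorem squarefreeDivisorSum_eq_sum_Icc {M N : ℕ} (h : N < (M + 1) ^ 2) :
    squarefreeDivisorSum N = ∑ q ∈ Icc 1 M with Squarefree q, q * (N / q ^ 2) := by
  rw [squarefreeDivisorSum, sum_filter, sum_filter]
  refine sum_Icc_one_eq_of_forall_eq_zero (fun q hq => ?_) fun q hq => ?_
  · rw [Nat.div_eq_of_lt (hq.trans_le (Nat.le_self_pow two_ne_zero q)), mul_zero, ite_self]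
  · rw [Nat.div_eq_of_lt (h.trans_le (Nat.pow_le_pow_left hq 2)), mul_zero, ite_self]

theorem sum_subringCount {M N : ℕ} (h : N < (M + 1) ^ 3) :
    ∑ n ∈ Icc 1 N, subringCount n = ∑ l ∈ Icc 1 M, l ^ 2 * squarefreeDivisorSum (N / l ^ 3) := by
  have hcount (q l : ℕ) (hq : Squarefree q) :
      ∑ a ∈ Icc 1 (N / (q * l ^ 2)), (if q * l ^ 2 ∣ a ^ 2 then q * l ^ 2 else 0) =
        l ^ 2 * (q * (N / l ^ 3 / q ^ 2)) := by
    simp only [squarefree_mul_sq_dvd_sq_iff hq]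
    rw [← sum_filter, sum_const, smul_eq_mul]
    have hcard := Nat.Ioc_filter_dvd_card_eq_div (N / (q * l ^ 2)) (q * l)
    rw [show Icc 1 (N / (q * l ^ 2)) = Ioc 0 (N / (q * l ^ 2)) from rfl, hcard,
      Nat.div_div_eq_div_mul, Nat.div_div_eq_div_mul]
    ring_nf
  calc ∑ n ∈ Icc 1 N, subringCount n
      = ∑ n ∈ Icc 1 N, ∑ p ∈ n.divisorsAntidiagonal, if p.2 ∣ p.1 ^ 2 then p.2 else 0 :=
        sum_congr rfl fun n hn => by
          rw [subringCount_eq_sum (Nat.ne_of_gt (mem_Icc.1 hn).1), sum_filter]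
    _ = ∑ d ∈ Icc 1 N, ∑ a ∈ Icc 1 (N / d), if d ∣ a ^ 2 then d else 0 :=
        sum_Icc_sum_divisorsAntidiagonal (fun a d => if d ∣ a ^ 2 then d else 0) N
    _ = ∑ l ∈ Icc 1 N, ∑ q ∈ Icc 1 N with Squarefree q, l ^ 2 * (q * (N / l ^ 3 / q ^ 2)) := by
        rw [sum_Icc_eq_sum_squarefree_mul_sq fun d hd => by simp [Nat.div_eq_of_lt hd]]
        exact sum_congr rfl fun l _ => sum_congr rfl fun q hq => hcount q l (mem_filter.1 hq).2
    _ = ∑ l ∈ Icc 1 N, l ^ 2 * squarefreeDivisorSum (N / l ^ 3) := by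
        refine sum_congr rfl fun l _ => ?_
        rw [← mul_sum, ← squarefreeDivisorSum_eq_sum_Icc]
        exact (Nat.div_le_self _ _).trans_lt
          (N.lt_succ_self.trans_le (Nat.le_self_pow two_ne_zero _))
    _ = ∑ l ∈ Icc 1 M, l ^ 2 * squarefreeDivisorSum (N / l ^ 3) := by
        refine sum_Icc_one_eq_of_forall_eq_zero (fun l hl => ?_) fun l hl => ?_
        · rw [Nat.div_eq_of_lt (hl.trans_le (Nat.le_self_pow three_ne_zero l))]
          rfl
        · rw [Nat.div_eq_of_lt (h.trans_le (Nat.pow_le_pow_left hl 3))]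
          rfl

section Moebius

open ArithmeticFunction

theorem sum_moebius_of_sq_dvd {n N : ℕ} (hn : n ≠ 0) (hN : n ≤ N) :
    ∑ j ∈ Icc 1 N with j ^ 2 ∣ n, moebius j = if Squarefree n then 1 else 0 := by
  obtain ⟨q, l, hq, rfl, -, hl⟩ := exists_squarefree_mul_sq_eq hn
  rw [mem_Icc] at hl
  have hdivisors : {j ∈ Icc 1 N | j ^ 2 ∣ q * l ^ 2} = l.divisors := by
    ext j
    rw [mem_filter, Nat.mem_divisors, sq_dvd_squarefree_mul_sq_iff hq, mem_Icc]
    constructor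
    · exact fun h => ⟨h.2, by lia⟩
    · rintro ⟨hj, -⟩
      exact ⟨⟨Nat.pos_of_dvd_of_pos hj hl.1, ((Nat.le_of_dvd hl.1 hj).trans hl.2).trans hN⟩, hj⟩
  have hsquarefree : l = 1 ↔ Squarefree (q * l ^ 2) := by
    constructor
    · rintro rfl
      simpa using hq
    · exact fun h => Nat.isUnit_iff.1 (h l (by rw [← sq]; exact dvd_mul_left _ _))
  rw [hdivisors, ← coe_mul_zeta_apply, moebius_mul_coe_zeta, one_apply]
  simp only [hsquarefree]

theorem hasSum_moebius_div_pow {k : ℕ} (hk : 1 < k) :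
    HasSum (fun j : ℕ => (moebius j : ℝ) / (j : ℝ) ^ k) (riemannZeta k)⁻¹.re := by
  have hk' : 1 < (k : ℂ).re := by rwa [Complex.natCast_re, Nat.one_lt_cast]
  have hsum : HasSum (LSeries.term (fun j => (moebius j : ℂ)) k) (riemannZeta k)⁻¹ := by
    have hmul := LSeries_zeta_mul_Lseries_moebius hk'
    rw [LSeries_zeta_eq_riemannZeta hk'] at hmul
    rw [← eq_inv_of_mul_eq_one_right hmul]
    exact (LSeriesSummable_moebius_iff.2 hk').hasSum
  convert Complex.hasSum_re hsum using 1
  ext j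
  rcases eq_or_ne j 0 with rfl | hj
  · simp
  · rw [LSeries.term_of_ne_zero hj, Complex.cpow_natCast]
    norm_cast

theorem sum_inv_filter_dvd (N : ℕ) {k : ℕ} (hk : k ≠ 0) :
    ∑ n ∈ Icc 1 N with k ∣ n, (n : ℝ)⁻¹ = (k : ℝ)⁻¹ * harmonic (N / k) := by
  rw [sum_Icc_filter_dvd _ _ hk, harmonic_eq_sum_Icc]
  push_cast
  simp only [mul_inv, mul_sum]

theorem sum_squarefree_inv_eq (N : ℕ) :
    ∑ q ∈ Icc 1 N with Squarefree q, (q : ℝ)⁻¹ =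
      ∑ j ∈ Icc 1 N, (moebius j : ℝ) / (j : ℝ) ^ 2 * harmonic (N / j ^ 2) :=
  calc ∑ q ∈ Icc 1 N with Squarefree q, (q : ℝ)⁻¹
      = ∑ n ∈ Icc 1 N, ∑ j ∈ Icc 1 N with j ^ 2 ∣ n, (moebius j : ℝ) * (n : ℝ)⁻¹ := by
        rw [sum_filter]
        refine sum_congr rfl fun n hn => ?_
        rw [mem_Icc] at hn
        rw [← sum_mul, ← Int.cast_sum, sum_moebius_of_sq_dvd (by lia) hn.2]
        split_ifs <;> simp
    _ = ∑ j ∈ Icc 1 N, ∑ n ∈ Icc 1 N with j ^ 2 ∣ n, (moebius j : ℝ) * (n : ℝ)⁻¹ := by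
        simp only [sum_filter]
        exact sum_comm
    _ = ∑ j ∈ Icc 1 N, (moebius j : ℝ) / (j : ℝ) ^ 2 * harmonic (N / j ^ 2) := by
        refine sum_congr rfl fun j hj => ?_
        rw [← mul_sum, sum_inv_filter_dvd N (pow_ne_zero 2 (Nat.ne_of_gt (mem_Icc.1 hj).1)),
          Nat.cast_pow, div_mul_eq_mul_div, mul_div_assoc, inv_mul_eq_div]

/-- As a series, the sum can be compared term by term with the Möbius series for `1 / ζ(2)`. -/
theorem hasSum_moebius_mul_harmonic (N : ℕ) :
    HasSum (fun j : ℕ => (moebius j : ℝ) / (j : ℝ) ^ 2 * harmonic (N / j ^ 2))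
      (∑ q ∈ Icc 1 N with Squarefree q, (q : ℝ)⁻¹) := by
  rw [sum_squarefree_inv_eq]
  refine hasSum_sum_of_ne_finset_zero fun j hj => ?_
  rcases Nat.eq_zero_or_pos j with rfl | hj0
  · simp
  · have hlt : N < j ^ 2 := by
      have := Nat.le_self_pow two_ne_zero j
      rw [mem_Icc] at hj
      lia
    simp [Nat.div_eq_of_lt hlt]

end Moebius

section SquarefreeSums

open Real

theorem abs_harmonic_floor_div_sub_log_le {x : ℝ} (hx : 1 ≤ x) {k : ℕ} (hk : k ≠ 0) :
    |harmonic (⌊x⌋₊ / k) - log x| ≤ 1 + log k := by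
  have hk' : (0 : ℝ) < k := by positivity
  have hlog : log (x / k) = log x - log k := log_div (by positivity) hk'.ne'
  have hlogk : 0 ≤ log k := log_natCast_nonneg k
  rw [← Nat.floor_div_natCast, abs_sub_le_iff]
  constructor
  · rcases le_or_gt 1 (x / k) with h | h
    · linarith [harmonic_floor_le_one_add_log _ h]
    · have hlogx : 0 ≤ log x := log_nonneg hx
      rw [Nat.floor_eq_zero.2 h, harmonic_zero, Rat.cast_zero]
      linarith
  · linarith [log_le_harmonic_floor (x / k) (by positivity)]

theorem one_add_two_mul_log_div_sq_le {x : ℝ} (hx : 1 ≤ x) :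
    (1 + 2 * log x) / x ^ 2 ≤ 5 * (1 / x ^ (3 / 2 : ℝ)) := by
  have hx0 : 0 < x := by linarith
  have hlog : log x ≤ x ^ (1 / 2 : ℝ) / (1 / 2) := log_le_rpow_div hx0.le (by norm_num)
  have hone : 1 ≤ x ^ (1 / 2 : ℝ) := one_le_rpow hx (by norm_num)
  have hpow : x ^ 2 = x ^ (1 / 2 : ℝ) * x ^ (3 / 2 : ℝ) := by
    rw [← rpow_add hx0, ← rpow_natCast]
    norm_num
  calc (1 + 2 * log x) / x ^ 2
      ≤ 5 * x ^ (1 / 2 : ℝ) / x ^ 2 := by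
        gcongr
        linarith
    _ = 5 * (1 / x ^ (3 / 2 : ℝ)) := by
        rw [hpow]
        field_simp

theorem riemannZeta_two_eq_ofReal : riemannZeta 2 = ((π ^ 2 / 6 : ℝ) : ℂ) := by
  rw [riemannZeta_two]
  push_cast
  rfl

theorem hasSum_moebius_div_sq :
    HasSum (fun j : ℕ => (ArithmeticFunction.moebius j : ℝ) / (j : ℝ) ^ 2)
      (riemannZeta 2).re⁻¹ := by
  convert hasSum_moebius_div_pow one_lt_two using 1
  rw [Nat.cast_ofNat, riemannZeta_two_eq_ofReal, ← Complex.ofReal_inv, Complex.ofReal_re,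
    Complex.ofReal_re]

theorem exists_abs_sum_squarefree_inv_sub_le :
    ∃ C, ∀ x : ℝ, 1 ≤ x →
      |∑ q ∈ Icc 1 ⌊x⌋₊ with Squarefree q, (q : ℝ)⁻¹ - (riemannZeta 2).re⁻¹ * log x| ≤ C := by
  have hsummable : Summable fun j : ℕ => 5 * (1 / (j : ℝ) ^ (3 / 2 : ℝ)) :=
    (summable_one_div_nat_rpow.2 (by norm_num)).mul_left 5
  refine ⟨∑' j : ℕ, 5 * (1 / (j : ℝ) ^ (3 / 2 : ℝ)), fun x hx => ?_⟩
  have hsum := (hasSum_moebius_mul_harmonic ⌊x⌋₊).sub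
    (hasSum_moebius_div_sq.mul_right (log x))
  refine hsum.norm_le_of_bounded hsummable.hasSum fun j => ?_
  rcases Nat.eq_zero_or_pos j with rfl | hj
  · simp
  have hmoebius : |(ArithmeticFunction.moebius j : ℝ)| ≤ 1 := by
    exact_mod_cast ArithmeticFunction.abs_moebius_le_one
  have hharmonic : |harmonic (⌊x⌋₊ / j ^ 2) - log x| ≤ 1 + 2 * log j := by
    simpa using abs_harmonic_floor_div_sub_log_le hx (pow_ne_zero 2 hj.ne')
  rw [← mul_sub, norm_eq_abs, abs_mul, abs_div, abs_of_pos (by positivity : 0 < (j : ℝ) ^ 2)]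
  calc |(ArithmeticFunction.moebius j : ℝ)| / (j : ℝ) ^ 2 * |harmonic (⌊x⌋₊ / j ^ 2) - log x|
      ≤ 1 / (j : ℝ) ^ 2 * (1 + 2 * log j) := by gcongr
    _ = (1 + 2 * log j) / (j : ℝ) ^ 2 := one_div_mul_eq_div _ _
    _ ≤ 5 * (1 / (j : ℝ) ^ (3 / 2 : ℝ)) := one_add_two_mul_log_div_sq_le (mod_cast hj)

end SquarefreeSums

section LogSums

open Real

theorem continuousOn_inv_uIcc_one {x : ℝ} (hx : 1 ≤ x) :
    ContinuousOn (fun t : ℝ => t⁻¹) (Set.uIcc 1 x) := by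
  refine continuousOn_id.inv₀ fun t ht => ?_
  rw [Set.uIcc_of_le hx] at ht
  exact (zero_lt_one.trans_le ht.1).ne'

theorem intervalIntegrable_inv_mul_log {x : ℝ} (hx : 1 ≤ x) :
    IntervalIntegrable (fun t => t⁻¹ * log t) MeasureTheory.volume 1 x :=
  intervalIntegral.intervalIntegrable_log'.continuousOn_mul (continuousOn_inv_uIcc_one hx)

theorem intervalIntegrable_inv_mul_harmonic_floor {x : ℝ} (hx : 1 ≤ x) :
    IntervalIntegrable (fun t => t⁻¹ * (harmonic ⌊t⌋₊ : ℝ)) MeasureTheory.volume 1 x := by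
  have hharmonic : Monotone harmonic := monotone_nat_of_le_succ fun n => by
    rw [harmonic_succ]
    exact le_add_of_nonneg_right (by positivity)
  have hmono : Monotone fun t : ℝ => (harmonic ⌊t⌋₊ : ℝ) :=
    (Rat.cast_mono.comp hharmonic).comp Nat.floor_mono
  exact hmono.intervalIntegrable.continuousOn_mul (continuousOn_inv_uIcc_one hx)

theorem integral_inv_mul_log {x : ℝ} (hx : 1 ≤ x) : ∫ t in 1..x, t⁻¹ * log t = log x ^ 2 / 2 := by
  have hderiv (t : ℝ) (ht : t ∈ Set.uIcc 1 x) :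
      HasDerivAt (fun s => log s ^ 2 / 2) (t⁻¹ * log t) t := by
    rw [Set.uIcc_of_le hx] at ht
    refine (((hasDerivAt_log (zero_lt_one.trans_le ht.1).ne').pow 2).div_const 2).congr_deriv ?_
    ring
  rw [intervalIntegral.integral_eq_sub_of_hasDerivAt hderiv (intervalIntegrable_inv_mul_log hx)]
  simp

theorem sum_inv_mul_log_div_eq_integral {x : ℝ} (hx : 1 ≤ x) :
    ∑ l ∈ Icc 1 ⌊x⌋₊, (l : ℝ)⁻¹ * log (x / l) = ∫ t in 1..x, t⁻¹ * harmonic ⌊t⌋₊ := by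
  have hdiff (t : ℝ) (ht : t ∈ Set.Icc 1 x) : DifferentiableAt ℝ (fun s => log x - log s) t :=
    (differentiableAt_log (zero_lt_one.trans_le ht.1).ne').const_sub (log x)
  have hderiv : deriv (fun s => log x - log s) = fun s => -s⁻¹ := by
    ext s
    rw [deriv_const_sub, deriv_log]
  have hint : MeasureTheory.IntegrableOn (fun s : ℝ => -s⁻¹) (Set.Icc 1 x) := by
    rw [← Set.uIcc_of_le hx]
    exact (continuousOn_inv_uIcc_one hx).neg.integrableOn_compact isCompact_uIcc
  have hIcc (f : ℕ → ℝ) (hf : f 0 = 0) (n : ℕ) : ∑ l ∈ Icc 0 n, f l = ∑ l ∈ Icc 1 n, f l := by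
    rw [← add_sum_Ioc_eq_sum_Icc n.zero_le, hf, zero_add]
    rfl
  have hharmonic (n : ℕ) : ∑ l ∈ Icc 0 n, (l : ℝ)⁻¹ = harmonic n := by
    rw [hIcc _ (by simp), harmonic_eq_sum_Icc]
    push_cast
    rfl
  have habel := sum_mul_eq_sub_integral_mul₀ (f := fun s => log x - log s)
    (fun l : ℕ => (l : ℝ)⁻¹) (by simp) x hdiff (hderiv ▸ hint)
  simp only [hharmonic, hderiv, sub_self, zero_mul, zero_sub, neg_mul,
    MeasureTheory.integral_neg, neg_neg] at habel
  rw [hIcc _ (by simp), ← intervalIntegral.integral_of_le hx] at habel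
  rw [← habel]
  refine sum_congr rfl fun l hl => ?_
  have hl0 : (l : ℝ) ≠ 0 := Nat.cast_ne_zero.2 (Nat.ne_of_gt (mem_Icc.1 hl).1)
  rw [log_div (by positivity) hl0, mul_comm]

theorem abs_sum_inv_mul_log_div_sub_le {x : ℝ} (hx : 1 ≤ x) :
    |∑ l ∈ Icc 1 ⌊x⌋₊, (l : ℝ)⁻¹ * log (x / l) - log x ^ 2 / 2| ≤ log x := by
  have hbound (t : ℝ) (ht : t ∈ Set.Ioc 1 x) :
      ‖t⁻¹ * harmonic ⌊t⌋₊ - t⁻¹ * log t‖ ≤ t⁻¹ := by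
    have ht0 : 0 < t := zero_lt_one.trans ht.1
    have hsub : |harmonic ⌊t⌋₊ - log t| ≤ 1 := by
      rw [abs_sub_le_iff]
      constructor
      · linarith [harmonic_floor_le_one_add_log t ht.1.le]
      · linarith [log_le_harmonic_floor t ht0.le]
    rw [← mul_sub, norm_mul, norm_of_nonneg (inv_nonneg.2 ht0.le)]
    exact mul_le_of_le_one_right (inv_nonneg.2 ht0.le) hsub
  rw [sum_inv_mul_log_div_eq_integral hx, ← integral_inv_mul_log hx,
    ← intervalIntegral.integral_sub (intervalIntegrable_inv_mul_harmonic_floor hx)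
      (intervalIntegrable_inv_mul_log hx)]
  calc _ ≤ ∫ t in 1..x, t⁻¹ :=
        intervalIntegral.norm_integral_le_of_norm_le hx (.of_forall hbound)
          (continuousOn_inv_uIcc_one hx).intervalIntegrable
    _ = log x := by rw [integral_inv_of_pos one_pos (by positivity), div_one]

end LogSums

section Asymptotics

open Real

theorem abs_sum_mul_floor_sub_le {y : ℝ} (hy : 0 ≤ y) {s : Finset ℕ} (hs : s ⊆ Icc 1 ⌊y⌋₊) :
    |∑ q ∈ s, (q : ℝ) * ⌊y ^ 2 / (q : ℝ) ^ 2⌋₊ - y ^ 2 * ∑ q ∈ s, (q : ℝ)⁻¹| ≤ y ^ 2 := by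
  have hterm (q : ℕ) (hq : q ∈ s) :
      |(q : ℝ) * ⌊y ^ 2 / (q : ℝ) ^ 2⌋₊ - y ^ 2 * (q : ℝ)⁻¹| ≤ y := by
    obtain ⟨hq1, hqy⟩ := mem_Icc.1 (hs hq)
    have hq0 : (0 : ℝ) < q := Nat.cast_pos.2 hq1
    have hfloor : |(⌊y ^ 2 / (q : ℝ) ^ 2⌋₊ : ℝ) - y ^ 2 / (q : ℝ) ^ 2| ≤ 1 := by
      rw [abs_sub_comm, abs_of_nonneg (sub_nonneg.2 (Nat.floor_le (by positivity)))]
      exact (sub_lt_iff_lt_add'.2 (Nat.lt_floor_add_one _)).le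
    have hmain : y ^ 2 * (q : ℝ)⁻¹ = q * (y ^ 2 / (q : ℝ) ^ 2) := by field_simp
    rw [hmain, ← mul_sub, abs_mul, abs_of_pos hq0]
    exact (mul_le_of_le_one_right hq0.le hfloor).trans ((Nat.le_floor_iff hy).1 hqy)
  have hcard : (s.card : ℝ) ≤ y := by
    refine (Nat.cast_le.2 (card_le_card hs)).trans ?_
    rw [Nat.card_Icc, Nat.add_sub_cancel]
    exact Nat.floor_le hy
  rw [mul_sum, ← sum_sub_distrib]
  calc _ ≤ ∑ q ∈ s, |(q : ℝ) * ⌊y ^ 2 / (q : ℝ) ^ 2⌋₊ - y ^ 2 * (q : ℝ)⁻¹| := abs_sum_le_sum_abs _ _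
    _ ≤ s.card • y := sum_le_card_nsmul _ _ _ hterm
    _ ≤ y ^ 2 := by
      rw [nsmul_eq_mul, sq]
      gcongr

theorem exists_abs_squarefreeDivisorSum_sub_le :
    ∃ K, ∀ z : ℝ, 1 ≤ z →
      |squarefreeDivisorSum ⌊z⌋₊ - (riemannZeta 2).re⁻¹ / 2 * (z * log z)| ≤ K * z := by
  obtain ⟨C, hC⟩ := exists_abs_sum_squarefree_inv_sub_le
  refine ⟨1 + C, fun z hz => ?_⟩
  have hz0 : 0 ≤ z := zero_le_one.trans hz
  set s : Finset ℕ := {q ∈ Icc 1 ⌊√z⌋₊ | Squarefree q}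
  have hsum : (squarefreeDivisorSum ⌊z⌋₊ : ℝ) = ∑ q ∈ s, (q : ℝ) * ⌊√z ^ 2 / (q : ℝ) ^ 2⌋₊ := by
    have hlt : ⌊z⌋₊ < (⌊√z⌋₊ + 1) ^ 2 := by
      rw [Nat.floor_lt hz0, Nat.cast_pow, ← sqrt_lt' (by positivity)]
      exact_mod_cast Nat.lt_floor_add_one √z
    rw [squarefreeDivisorSum_eq_sum_Icc hlt, sq_sqrt hz0, Nat.cast_sum]
    refine sum_congr rfl fun q _ => ?_
    rw [Nat.cast_mul, ← Nat.floor_div_natCast, Nat.cast_pow]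
  have hfloor := abs_sum_mul_floor_sub_le (sqrt_nonneg z) (filter_subset Squarefree (Icc 1 ⌊√z⌋₊))
  have hinv : |z * ∑ q ∈ s, (q : ℝ)⁻¹ - (riemannZeta 2).re⁻¹ / 2 * (z * log z)| ≤ C * z := by
    have hfactor : (riemannZeta 2).re⁻¹ / 2 * (z * log z) =
        z * ((riemannZeta 2).re⁻¹ * log √z) := by
      rw [log_sqrt hz0]
      ring
    rw [hfactor, ← mul_sub, abs_mul, abs_of_nonneg hz0, mul_comm]
    exact mul_le_mul_of_nonneg_right (hC √z (one_le_sqrt.2 hz)) hz0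
  rw [← hsum, sq_sqrt hz0] at hfloor
  calc _ ≤ _ := abs_sub_le _ (z * ∑ q ∈ s, (q : ℝ)⁻¹) _
    _ ≤ z + C * z := add_le_add hfloor hinv
    _ = (1 + C) * z := by ring

theorem pow_mul_div_pow_succ (x : ℝ) {l : ℕ} (hl : l ≠ 0) (k : ℕ) :
    (l : ℝ) ^ k * (x / l) ^ (k + 1) = x ^ (k + 1) * (l : ℝ)⁻¹ := by
  rw [div_pow, pow_succ (l : ℝ)]
  field_simp

theorem abs_sum_pow_mul_dilate_sub_le {f g : ℝ → ℝ} {K : ℝ}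
    (hfg : ∀ z, 1 ≤ z → |f z - g z| ≤ K * z) (k : ℕ) {x : ℝ} (hx : 1 ≤ x) :
    |∑ l ∈ Icc 1 ⌊x⌋₊, (l : ℝ) ^ k * f ((x / l) ^ (k + 1)) -
        ∑ l ∈ Icc 1 ⌊x⌋₊, (l : ℝ) ^ k * g ((x / l) ^ (k + 1))| ≤
      K * (x ^ (k + 1) * (1 + log x)) := by
  have hK : 0 ≤ K := (abs_nonneg _).trans (by simpa using hfg 1 le_rfl)
  have hterm (l : ℕ) (hl : l ∈ Icc 1 ⌊x⌋₊) :
      |(l : ℝ) ^ k * f ((x / l) ^ (k + 1)) - (l : ℝ) ^ k * g ((x / l) ^ (k + 1))| ≤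
        K * x ^ (k + 1) * (l : ℝ)⁻¹ := by
    obtain ⟨hl1, hlx⟩ := mem_Icc.1 hl
    have hl0 : (0 : ℝ) < l := Nat.cast_pos.2 hl1
    have hone : 1 ≤ x / l := (one_le_div hl0).2 ((Nat.le_floor_iff (by positivity)).1 hlx)
    rw [mul_assoc, ← pow_mul_div_pow_succ x (Nat.ne_of_gt hl1), mul_left_comm, ← mul_sub, abs_mul,
      abs_of_nonneg (by positivity)]
    gcongr
    exact hfg _ (one_le_pow₀ hone)
  have hharmonic := harmonic_floor_le_one_add_log x hx
  rw [harmonic_eq_sum_Icc] at hharmonic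
  push_cast at hharmonic
  rw [← sum_sub_distrib]
  calc _ ≤ ∑ l ∈ Icc 1 ⌊x⌋₊, K * x ^ (k + 1) * (l : ℝ)⁻¹ :=
        (abs_sum_le_sum_abs _ _).trans (sum_le_sum hterm)
    _ ≤ K * (x ^ (k + 1) * (1 + log x)) := by
        rw [← mul_sum, mul_assoc]
        gcongr

theorem abs_sum_pow_mul_dilate_mul_log_sub_le (k : ℕ) {x : ℝ} (hx : 1 ≤ x) :
    |∑ l ∈ Icc 1 ⌊x⌋₊, (l : ℝ) ^ k * ((x / l) ^ (k + 1) * log ((x / l) ^ (k + 1))) -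
        (k + 1) / 2 * (x ^ (k + 1) * log x ^ 2)| ≤
      (k + 1) * (x ^ (k + 1) * log x) := by
  have hsum : ∑ l ∈ Icc 1 ⌊x⌋₊, (l : ℝ) ^ k * ((x / l) ^ (k + 1) * log ((x / l) ^ (k + 1))) =
      (k + 1) * x ^ (k + 1) * ∑ l ∈ Icc 1 ⌊x⌋₊, (l : ℝ)⁻¹ * log (x / l) := by
    rw [mul_sum]
    refine sum_congr rfl fun l hl => ?_
    rw [← mul_assoc, pow_mul_div_pow_succ x (Nat.ne_of_gt (mem_Icc.1 hl).1), log_pow]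
    push_cast
    ring
  have hfactor : (k + 1) / 2 * (x ^ (k + 1) * log x ^ 2) =
      (k + 1) * x ^ (k + 1) * (log x ^ 2 / 2) := by ring
  rw [hsum, hfactor, ← mul_sub, abs_mul, abs_of_nonneg (by positivity), ← mul_assoc]
  gcongr
  exact abs_sum_inv_mul_log_div_sub_le hx

theorem sum_subringCount_floor_pow {x : ℝ} (hx : 0 ≤ x) :
    ∑ n ∈ Icc 1 ⌊x ^ 3⌋₊, (subringCount n : ℝ) =
      ∑ l ∈ Icc 1 ⌊x⌋₊, (l : ℝ) ^ 2 * squarefreeDivisorSum ⌊(x / l) ^ 3⌋₊ := by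
  have hlt : ⌊x ^ 3⌋₊ < (⌊x⌋₊ + 1) ^ 3 := by
    rw [Nat.floor_lt (by positivity)]
    push_cast
    gcongr
    exact Nat.lt_floor_add_one x
  rw [← Nat.cast_sum, sum_subringCount hlt, Nat.cast_sum]
  refine sum_congr rfl fun l _ => ?_
  rw [div_pow, ← Nat.cast_pow l 3, Nat.floor_div_natCast]
  push_cast
  rfl

theorem exists_abs_sum_subringCount_sub_le :
    ∃ K, ∀ B : ℝ, 1 ≤ B →
      |∑ n ∈ Icc 1 ⌊B⌋₊, (subringCount n : ℝ) - 1 / (12 * (riemannZeta 2).re) * (B * log B ^ 2)| ≤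
        K * (B * (1 + log B)) := by
  obtain ⟨K, hK⟩ := exists_abs_squarefreeDivisorSum_sub_le
  have hK0 : 0 ≤ K := (abs_nonneg _).trans ((hK 1 le_rfl).trans_eq (mul_one K))
  set a := (riemannZeta 2).re⁻¹ / 2 with ha
  refine ⟨K + 3 * |a|, fun B hB => ?_⟩
  obtain ⟨x, hx, rfl⟩ : ∃ x : ℝ, 1 ≤ x ∧ x ^ 3 = B :=
    ⟨B ^ ((3 : ℕ) : ℝ)⁻¹, one_le_rpow hB (by positivity),
      rpow_inv_natCast_pow (by positivity) three_ne_zero⟩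
  set S := ∑ l ∈ Icc 1 ⌊x⌋₊, (l : ℝ) ^ 2 * ((x / l) ^ 3 * log ((x / l) ^ 3)) with hS
  have hmain : 1 / (12 * (riemannZeta 2).re) * (x ^ 3 * log (x ^ 3) ^ 2) =
      a * (3 / 2 * (x ^ 3 * log x ^ 2)) := by
    rw [ha, log_pow]
    push_cast
    ring
  have hcount : |∑ n ∈ Icc 1 ⌊x ^ 3⌋₊, (subringCount n : ℝ) - a * S| ≤
      K * (x ^ 3 * (1 + log x)) := by
    have hdilate := abs_sum_pow_mul_dilate_sub_le hK 2 hx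
    simp only [Nat.reduceAdd, mul_left_comm _ a, ← mul_sum, ← hS] at hdilate
    rwa [sum_subringCount_floor_pow (by positivity)]
  have hlog : |a * S - a * (3 / 2 * (x ^ 3 * log x ^ 2))| ≤ |a| * (3 * (x ^ 3 * log x)) := by
    have hdilate := abs_sum_pow_mul_dilate_mul_log_sub_le 2 hx
    norm_num only [← hS] at hdilate
    rw [← mul_sub, abs_mul]
    gcongr
  have hle : log x ≤ 1 + log (x ^ 3) :=
    (log_le_log (by positivity) (le_self_pow₀ hx three_ne_zero)).trans
      (le_add_of_nonneg_left zero_le_one)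
  rw [hmain]
  calc _ ≤ _ := abs_sub_le _ (a * S) _
    _ ≤ K * (x ^ 3 * (1 + log x)) + |a| * (3 * (x ^ 3 * log x)) := add_le_add hcount hlog
    _ ≤ K * (x ^ 3 * (1 + log (x ^ 3))) + |a| * (3 * (x ^ 3 * (1 + log (x ^ 3)))) := by
        gcongr
        exact le_self_pow₀ hx three_ne_zero
    _ = (K + 3 * |a|) * (x ^ 3 * (1 + log (x ^ 3))) := by ring

theorem one_add_log_isLittleO_log_sq :
    (fun x => 1 + log x) =o[Filter.atTop] fun x => log x ^ 2 := by
  have hone : (fun _ : ℝ => (1 : ℝ)) =o[Filter.atTop] fun y => y ^ 2 := by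
    simpa only [pow_zero] using
      Asymptotics.isLittleO_pow_pow_atTop_of_lt (𝕜 := ℝ) (zero_lt_two (α := ℕ))
  have hid : (fun y : ℝ => y) =o[Filter.atTop] fun y => y ^ 2 := by
    simpa only [pow_one] using
      Asymptotics.isLittleO_pow_pow_atTop_of_lt (𝕜 := ℝ) (one_lt_two (α := ℕ))
  exact (hone.add hid).comp_tendsto tendsto_log_atTop

end Asymptotics

theorem corollary6 :
    (∀ n : ℕ, 1 ≤ n → (subringsOfIndex n).Finite) ∧
    Asymptotics.IsEquivalent Filter.atTop
      (fun B : ℝ => ∑ n ∈ Finset.Icc 1 ⌊B⌋₊, (subringCount n : ℝ))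
      (fun B : ℝ => 1 / (12 * (riemannZeta 2).re) * (B * Real.log B ^ 2)) := by
  refine ⟨fun n hn => finite_subringsOfIndex (Nat.ne_of_gt hn), ?_⟩
  obtain ⟨K, hK⟩ := exists_abs_sum_subringCount_sub_le
  have hO : (fun B : ℝ => ∑ n ∈ Icc 1 ⌊B⌋₊, (subringCount n : ℝ) -
      1 / (12 * (riemannZeta 2).re) * (B * Real.log B ^ 2)) =O[Filter.atTop]
      fun B => B * (1 + Real.log B) := by
    refine Asymptotics.IsBigO.of_bound K ?_
    filter_upwards [Filter.eventually_ge_atTop 1] with B hB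
    have hlog : 0 ≤ Real.log B := Real.log_nonneg hB
    rw [Real.norm_eq_abs, Real.norm_of_nonneg (by positivity)]
    exact hK B hB
  have ho : (fun B => B * (1 + Real.log B)) =o[Filter.atTop] fun B => B * Real.log B ^ 2 :=
    (Asymptotics.isBigO_refl _ _).mul_isLittleO one_add_log_isLittleO_log_sq
  have hzeta : 1 / (12 * (riemannZeta 2).re) ≠ 0 := by
    rw [riemannZeta_two_eq_ofReal, Complex.ofReal_re]
    positivity
  exact hO.trans_isLittleO (ho.const_mul_right hzeta)
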